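/- Let $\Gamma\subset\mathbb R^2$ be an oval, i.e. a closed smooth strictly convex curve: $\Gamma$ is the boundary of a compact strictly convex set with nonempty interior and admits a regular $C^\infty$ simple closed parametrization. For a direction $u$ (a nonzero vector up to scaling) let $I_u:\Gamma\to\Gamma$ be the chord involution: the line through $p\in\Gamma$ in direction $u$ meets $\Gamma$ exactly in $p$ and $I_u(p)$, where $I_u(p)=p$ if this line meets $\Gamma$ only at $p$. For a pair of directions $u,v$ put $T_{(u,v)}=I_v\circ I_u$. Let $\gamma:\mathbb R\to\mathbb R^2$ be a parametrization of $\Gamma$, i.e. a continuous map with image $\Gamma$ that is periodic with some period $L>0$ and injective on $[0,L)$. Suppose that for every pair of directions $u,v$ there is a constant $c(u,v)\in\mathbb R$ such that $$T_{(u,v)}(\gamma(t))=\gamma(t+c(u,v))\qquad\text{for all } t\in\mathbb R.$$ Then $\Gamma$ is an ellipse, i.e. the image of a circle under an invertible affine map of the plane. -/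

import Mathlib

/-- The plane. Directions are nonzero vectors of it, considered up to scaling. -/
abbrev Plane : Type := EuclideanSpace ℝ (Fin 2)

/-- `γ : ℝ → Plane` is an `L`-periodic parametrization of the simple closed curve `Γ`: a continuous
map, injective modulo the period `L > 0`, whose trace is `Γ`. -/
structure IsClosedParametrization (γ : ℝ → Plane) (L : ℝ) (Γ : Set Plane) : Prop where
  pos : 0 < L
  continuous : Continuous γ
  periodic : Function.Periodic γ L
  injOn : Set.InjOn γ (Set.Ico 0 L)
  range_eq : Set.range γ = Γ

/-- An oval: a closed smooth strictly convex plane curve. Smooth: it has a regular `C^∞` simple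
closed parametrization. Strictly convex: it is the boundary of a compact strictly convex set with
interior points. -/
structure IsOval (Γ : Set Plane) : Prop where
  smooth : ∃ (σ : ℝ → Plane) (L : ℝ), IsClosedParametrization σ L Γ ∧
    ContDiff ℝ (⊤ : ℕ∞) σ ∧ ∀ t, deriv σ t ≠ 0
  strictlyConvex : ∃ K : Set Plane, IsCompact K ∧ StrictConvex ℝ K ∧ (interior K).Nonempty ∧
    frontier K = Γ

/-- The line through the point `p` in the direction `u`. -/
def lineThrough (p u : Plane) : Set Plane := Set.range fun r : ℝ => p + r • u

open Classical in
/-- The chord involution of `Γ` in direction `u`: the line through `p ∈ Γ` in the direction `u`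
meets `Γ` exactly in `p` and the image of `p` (which is `p` itself if the line meets `Γ` at `p`
only). For ovals the `else` branch is never used on `Γ`, see `IsOval.chord`. -/
noncomputable def chordInvolution (Γ : Set Plane) (u p : Plane) : Plane :=
  if h : ∃ q, Γ ∩ lineThrough p u = {p, q} then h.choose else p

/-- The circle map `T_(u,v)`: first the chord involution in direction `u`, then the one in
direction `v`. -/
noncomputable def chordMap (Γ : Set Plane) (u v p : Plane) : Plane :=
  chordInvolution Γ v (chordInvolution Γ u p)

/-- An ellipse: the image of the unit circle under an invertible affine map of the plane. -/
def IsEllipse (Γ : Set Plane) : Prop :=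
  ∃ f : Plane ≃ᵃ[ℝ] Plane, Γ = f '' Metric.sphere (0 : Plane) 1

/-- The chord involution is well defined on an oval. -/
theorem IsOval.chord {Γ : Set Plane} (hΓ : IsOval Γ) {p : Plane} (hp : p ∈ Γ) (u : Plane) :
    Γ ∩ lineThrough p u = {p, chordInvolution Γ u p} := by
  obtain ⟨K, hK, hconv, -, rfl⟩ := hΓ.strictlyConvex
  have mid : ∀ x ∈ frontier K, ∀ y ∈ frontier K, ∀ z ∈ frontier K, x ≠ y →
      z ∉ openSegment ℝ x y := by
    intro x hx y hy z hz hxy hseg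
    exact hz.2 (hconv.openSegment_subset (hK.isClosed.frontier_subset hx)
      (hK.isClosed.frontier_subset hy) hxy hseg)
  have key : ∀ a b c : ℝ, a < b → b < c → p + a • u ∈ frontier K → p + b • u ∈ frontier K →
      p + c • u ∈ frontier K → u = 0 := by
    intro a b c hab hbc ha hb hc
    by_contra hu
    refine mid _ ha _ hc _ hb ?_ ?_
    · intro h
      have h1 : (a - c) • u = 0 := by
        rw [sub_smul]; exact sub_eq_zero.2 (add_left_cancel h)
      rcases smul_eq_zero.1 h1 with h2 | h2
      · linarith
      · exact hu h2
    · have hca : c - a ≠ 0 := by linarith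
      refine ⟨(c - b) / (c - a), (b - a) / (c - a), div_pos (by linarith) (by linarith),
        div_pos (by linarith) (by linarith), by field_simp; ring, ?_⟩
      have e1 : (c - b) / (c - a) + (b - a) / (c - a) = 1 := by field_simp; ring
      have e2 : (c - b) / (c - a) * a + (b - a) / (c - a) * c = b := by field_simp; ring
      calc _ = ((c - b) / (c - a) + (b - a) / (c - a)) • p
            + ((c - b) / (c - a) * a + (b - a) / (c - a) * c) • u := by module
        _ = p + b • u := by rw [e1, e2, one_smul]
  have hex : ∃ q, frontier K ∩ lineThrough p u = {p, q} := by
    have hpl : p ∈ lineThrough p u := ⟨0, by simp⟩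
    by_cases h : ∃ q ∈ frontier K ∩ lineThrough p u, q ≠ p
    · obtain ⟨q, ⟨hqK, s, rfl⟩, hqp⟩ := h
      simp only at hqK hqp
      have hu : u ≠ 0 := by rintro rfl; simp at hqp
      have hs : s ≠ 0 := by rintro rfl; simp at hqp
      have hp0 : p + (0 : ℝ) • u ∈ frontier K := by simpa using hp
      refine ⟨p + s • u, Set.Subset.antisymm ?_ ?_⟩
      · rintro x ⟨hx, r, rfl⟩
        simp only at hx
        by_contra hne
        have hr0 : r ≠ 0 := by rintro rfl; simp at hne
        have hrs : r ≠ s := by rintro rfl; simp at hne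
        rcases lt_or_gt_of_ne hr0 with h1 | h1 <;> rcases lt_or_gt_of_ne hs with h2 | h2 <;>
          rcases lt_or_gt_of_ne hrs with h3 | h3
        all_goals first
          | exact hu (key r s 0 (by linarith) (by linarith) hx hqK hp0)
          | exact hu (key s r 0 (by linarith) (by linarith) hqK hx hp0)
          | exact hu (key r 0 s (by linarith) (by linarith) hx hp0 hqK)
          | exact hu (key s 0 r (by linarith) (by linarith) hqK hp0 hx)
          | exact hu (key 0 r s (by linarith) (by linarith) hp0 hx hqK)
          | exact hu (key 0 s r (by linarith) (by linarith) hp0 hqK hx)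
      · rintro x (rfl | rfl)
        · exact ⟨hp, hpl⟩
        · exact ⟨hqK, s, rfl⟩
    · push Not at h
      refine ⟨p, Set.Subset.antisymm (fun x hx => Or.inl (h x hx)) ?_⟩
      rintro x (rfl | rfl) <;> exact ⟨hp, hpl⟩
  rw [chordInvolution, dif_pos hex]
  exact hex.choose_spec

/-!
Since `I_v ∘ I_u` translates the parameter for all `u, v`, the chord involutions agree up to
translations of the parameter. An involution whose composites with all the translations needed to
realize the chords of `Γ` are again involutions must be a reflection `t ↦ a - t`. Hence the direction
of the chord from `γ s` to `γ t` depends only on `s + t` (`exists_sub_eq_smul_sub`).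

Sample `γ` at the multiples of `L / (4 * N)`. Parallelism of the chords `p (k - 1) p (k + 2)` and
`p k p (k + 1)`, and of `p (k - 1) p (k + 3)` and `p k p (k + 2)`, makes the edges of the inscribed
polygon satisfy `d (k + 1) + d (k - 1) = μ • d k` with `μ` independent of `k`
(`exists_edge_recurrence`). Iterating the recurrence gives `d (k + N) + d (k - N) = ν • d k`, and the
period `4 * N` forces `ν = 0`, so the polygon has a centre of symmetry (`add_half_period_eq`), namely
the midpoint of `γ 0` and `γ (L / 2)`. The vertices relative to the centre satisfy the same recurrence;
its shift operator has determinant `1`, so the area spanned by the vertices `k` and `k + N` is constant,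
and the Plücker relation turns this into the equation of an ellipse (`cross_sq_add_cross_sq`). Its
conjugate semidiameters are the vertices `0` and `N`, that is `γ 0` and `γ (L / 4)` relative to the
centre, so the ellipse does not depend on `N`. By density of the rationals all of `Γ` lies on it.

Finally, a compact set with interior points whose frontier lies on an ellipse is bounded by the whole
ellipse (`frontier_eq_sphere_of_subset`).
-/

/-! ### Chords of the parametrized curve -/

theorem IsClosedParametrization.exists_eq_add_int_mul {γ : ℝ → Plane} {L : ℝ} {Γ : Set Plane}
    (hγ : IsClosedParametrization γ L Γ) {a b : ℝ} (h : γ a = γ b) :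
    ∃ n : ℤ, a = b + n * L := by
  have red : ∀ x, γ (toIcoMod hγ.pos 0 x) = γ x := fun x => by
    rw [← self_sub_toIcoDiv_zsmul, hγ.periodic.sub_zsmul_eq]
  have mem : ∀ x, toIcoMod hγ.pos 0 x ∈ Set.Ico 0 L := fun x => by
    simpa using toIcoMod_mem_Ico hγ.pos 0 x
  have e := hγ.injOn (mem a) (mem b) (by rw [red, red, h])
  rw [← self_sub_toIcoDiv_zsmul, ← self_sub_toIcoDiv_zsmul, zsmul_eq_mul, zsmul_eq_mul] at e
  refine ⟨toIcoDiv hγ.pos 0 a - toIcoDiv hγ.pos 0 b, ?_⟩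
  push_cast
  linarith

theorem IsClosedParametrization.apply_add_int_mul {γ : ℝ → Plane} {L : ℝ} {Γ : Set Plane}
    (hγ : IsClosedParametrization γ L Γ) (a : ℝ) (n : ℤ) : γ (a + n * L) = γ a :=
  hγ.periodic.int_mul n a

theorem IsClosedParametrization.mem {γ : ℝ → Plane} {L : ℝ} {Γ : Set Plane}
    (hγ : IsClosedParametrization γ L Γ) (t : ℝ) : γ t ∈ Γ :=
  hγ.range_eq ▸ Set.mem_range_self t

theorem IsOval.chordInvolution_mem {Γ : Set Plane} (hΓ : IsOval Γ) {p : Plane} (hp : p ∈ Γ)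
    (u : Plane) : chordInvolution Γ u p ∈ Γ ∩ lineThrough p u := by
  rw [hΓ.chord hp u]
  exact Or.inr rfl

theorem lineThrough_eq_of_mem {p q u : Plane} (h : q ∈ lineThrough p u) :
    lineThrough q u = lineThrough p u := by
  obtain ⟨r, rfl⟩ := h
  ext x
  constructor
  · rintro ⟨s, rfl⟩
    exact ⟨r + s, by simp only; module⟩
  · rintro ⟨s, rfl⟩
    exact ⟨s - r, by simp only; module⟩

theorem IsOval.chordInvolution_chordInvolution {Γ : Set Plane} (hΓ : IsOval Γ) {p : Plane}
    (hp : p ∈ Γ) (u : Plane) : chordInvolution Γ u (chordInvolution Γ u p) = p := by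
  obtain ⟨hq, hl⟩ := hΓ.chordInvolution_mem hp u
  have h1 := hΓ.chord hp u
  have h2 := hΓ.chord hq u
  rw [lineThrough_eq_of_mem hl, h1] at h2
  have h3 : p ∈ ({chordInvolution Γ u p, chordInvolution Γ u (chordInvolution Γ u p)} : Set Plane) :=
    h2 ▸ Or.inl rfl
  rcases h3 with h3 | h3
  · rw [← h3, ← h3]
  · exact h3.symm

theorem IsOval.chordInvolution_sub {Γ : Set Plane} (hΓ : IsOval Γ) {p q : Plane}
    (hp : p ∈ Γ) (hq : q ∈ Γ) (hpq : q ≠ p) : chordInvolution Γ (q - p) p = q := by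
  have h : q ∈ Γ ∩ lineThrough p (q - p) := ⟨hq, 1, by simp⟩
  rw [hΓ.chord hp] at h
  exact (h.resolve_left hpq).symm

/-- The curve parameter turns every chord involution into a reflection of the circle `ℝ / Lℤ`: the
sum of the parameters of the two endpoints depends only on the direction of the chord. -/
theorem exists_chordInvolution_eq_sub {Γ : Set Plane} (hΓ : IsOval Γ) {γ : ℝ → Plane} {L : ℝ}
    (hγ : IsClosedParametrization γ L Γ)
    (hT : ∀ u v : Plane, u ≠ 0 → v ≠ 0 →
      ∃ c : ℝ, ∀ t : ℝ, chordMap Γ u v (γ t) = γ (t + c))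
    {v : Plane} (hv : v ≠ 0) : ∃ a : ℝ, ∀ t, chordInvolution Γ v (γ t) = γ (a - t) := by
  have hφ : ∀ t, ∃ s, γ s = chordInvolution Γ v (γ t) := fun t => by
    have := hγ.range_eq.ge (hΓ.chordInvolution_mem (hγ.mem t) v).1
    exact this
  choose φ hφ using hφ
  have hinv : ∀ w, w ≠ 0 → ∃ c : ℝ, ∀ t, chordInvolution Γ w (γ t) = γ (φ t + c) := by
    intro w hw
    obtain ⟨c, hc⟩ := hT v w hv hw
    refine ⟨c, fun t => ?_⟩
    rw [← hc (φ t), chordMap, hφ, hΓ.chordInvolution_chordInvolution (hγ.mem t)]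
  -- The involution along the chord from `γ s` to `γ t` exchanges its endpoints and is `φ` up to a
  -- constant, so `φ s + s` and `φ t + t` agree modulo the period.
  have hsum : ∀ s t, ∃ n : ℤ, φ s + s = φ t + t + n * L := by
    intro s t
    by_cases hst : γ s = γ t
    · obtain ⟨n, hn⟩ := hγ.exists_eq_add_int_mul hst
      obtain ⟨m, hm⟩ := hγ.exists_eq_add_int_mul (a := φ s) (b := φ t) (by rw [hφ, hφ, hst])
      exact ⟨n + m, by push_cast; linarith⟩
    · obtain ⟨c, hc⟩ := hinv (γ s - γ t) (sub_ne_zero.2 hst)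
      have h1 := hΓ.chordInvolution_sub (hγ.mem t) (hγ.mem s) hst
      have h2 := hΓ.chordInvolution_chordInvolution (hγ.mem t) (γ s - γ t)
      rw [h1, hc] at h2
      rw [hc] at h1
      obtain ⟨n, hn⟩ := hγ.exists_eq_add_int_mul h1
      obtain ⟨m, hm⟩ := hγ.exists_eq_add_int_mul h2
      exact ⟨m - n, by push_cast; linarith⟩
  refine ⟨φ 0, fun t => ?_⟩
  obtain ⟨n, hn⟩ := hsum t 0
  rw [← hφ, ← hγ.apply_add_int_mul (φ 0 - t) n]
  congr 1
  linarith

/-- The direction of a chord depends only on the sum of the parameters of its endpoints. -/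
theorem exists_sub_eq_smul_sub {Γ : Set Plane} (hΓ : IsOval Γ) {γ : ℝ → Plane} {L : ℝ}
    (hγ : IsClosedParametrization γ L Γ)
    (hT : ∀ u v : Plane, u ≠ 0 → v ≠ 0 →
      ∃ c : ℝ, ∀ t : ℝ, chordMap Γ u v (γ t) = γ (t + c))
    {s t s' t' : ℝ} (hsum : s + t = s' + t') (hne : γ s ≠ γ t) :
    ∃ r : ℝ, γ s' - γ t' = r • (γ s - γ t) := by
  obtain ⟨a, ha⟩ := exists_chordInvolution_eq_sub hΓ hγ hT (sub_ne_zero.2 hne)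
  have h := hΓ.chordInvolution_sub (hγ.mem t) (hγ.mem s) hne
  rw [ha] at h
  obtain ⟨n, hn⟩ := hγ.exists_eq_add_int_mul h
  obtain ⟨-, r, hr⟩ := hΓ.chordInvolution_mem (hγ.mem t') (γ s - γ t)
  have e : a - t' = s' + n * L := by linarith
  rw [ha, e, hγ.apply_add_int_mul] at hr
  exact ⟨r, by rw [← hr]; simp⟩

/-! ### The area form -/

/-- The standard area form of the plane: the determinant of two vectors. -/
def cross (a b : Plane) : ℝ := a 0 * b 1 - a 1 * b 0

/-- No three points of an oval are collinear. -/
theorem cross_ne_zero_of_mem {Γ : Set Plane} (hΓ : IsOval Γ) {x y z : Plane} (hx : x ∈ Γ)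
    (hy : y ∈ Γ) (hz : z ∈ Γ) (hxy : x ≠ y) (hyz : y ≠ z) (hxz : x ≠ z) :
    cross (y - x) (z - y) ≠ 0 := by
  intro h
  have hz' : z ∈ lineThrough x (y - x) := by
    simp only [cross, PiLp.sub_apply] at h
    by_cases h0 : y 0 - x 0 = 0
    · have h1 : y 1 - x 1 ≠ 0 := fun h1 => hxy <| by
        ext i
        fin_cases i
        · simp; linarith
        · simp; linarith
      refine ⟨(z 1 - x 1) / (y 1 - x 1), ?_⟩
      ext i
      fin_cases i
      · have : z 0 - y 0 = 0 := by
          rw [h0] at h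
          have : (y 1 - x 1) * (z 0 - y 0) = 0 := by linarith
          exact (mul_eq_zero.1 this).resolve_left h1
        simp [h0]
        linarith
      · simp
        field_simp
        ring
    · refine ⟨(z 0 - x 0) / (y 0 - x 0), ?_⟩
      ext i
      fin_cases i
      · simp
        field_simp
        ring
      · simp
        field_simp
        linarith
  have hy' : y ∈ Γ ∩ lineThrough x (y - x) := ⟨hy, 1, by simp⟩
  have hz'' : z ∈ Γ ∩ lineThrough x (y - x) := ⟨hz, hz'⟩
  rw [hΓ.chord hx] at hy' hz''
  exact hyz ((hy'.resolve_left hxy.symm).trans (hz''.resolve_left hxz.symm).symm)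

/-! ### Polygons with parallel chords -/

/-- If the direction of a chord of a polygon depends only on the sum of the indices of its endpoints,
the edges satisfy a linear recurrence with a constant coefficient. -/
theorem exists_edge_recurrence {p : ℤ → Plane}
    (hpar : ∀ i j k l : ℤ, i + j = k + l → p i ≠ p j → ∃ r : ℝ, p k - p l = r • (p i - p j))
    (hcross : ∀ k, cross (p (k + 1) - p k) (p (k + 2) - p (k + 1)) ≠ 0)
    (hne : ∀ k, p (k + 1) ≠ p k) (hne2 : ∀ k, p (k + 2) ≠ p k) :
    ∃ μ : ℝ, ∀ k, p (k + 2) - p (k + 1) + (p k - p (k - 1)) = μ • (p (k + 1) - p k) := by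
  have h1 : ∀ k, ∃ r : ℝ, p (k + 2) - p (k - 1) = r • (p (k + 1) - p k) := fun k =>
    hpar _ _ _ _ (by ring) (hne k)
  choose r hr using h1
  have hstep : ∀ k, r (k + 1) = r k := by
    intro k
    obtain ⟨l, hl⟩ := hpar (k + 2) k (k + 3) (k - 1) (by ring) (hne2 k)
    have e1 := hr k
    have e2 := hr (k + 1)
    rw [show k + 1 + 2 = k + 3 by ring, show k + 1 - 1 = k by ring,
      show k + 1 + 1 = k + 2 by ring] at e2
    have hc := hcross k
    -- The chord from `p (k - 1)` to `p (k + 3)` written in the edges at `p (k + 1)`.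
    have e3 : (r k - 1 - l) • (p (k + 1) - p k) + (r (k + 1) - 1 - l) • (p (k + 2) - p (k + 1))
        = 0 := by
      have : (r k - 1 - l) • (p (k + 1) - p k) + (r (k + 1) - 1 - l) • (p (k + 2) - p (k + 1))
        = (r k • (p (k + 1) - p k)) + r (k + 1) • (p (k + 2) - p (k + 1))
          - (p (k + 2) - p k) - l • (p (k + 2) - p k) := by module
      rw [this, ← e1, ← e2, ← hl]
      abel
    have c0 := congrArg (fun x : Plane => x 0) e3
    have c1 := congrArg (fun x : Plane => x 1) e3
    simp only [cross, PiLp.sub_apply, PiLp.add_apply, PiLp.smul_apply, smul_eq_mul,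
      PiLp.zero_apply] at c0 c1 hc
    have f1 := mul_right_cancel₀ hc (show (r k - 1 - l) * _ = 0 * _ by
      linear_combination (p (k + 2) 1 - p (k + 1) 1) * c0 - (p (k + 2) 0 - p (k + 1) 0) * c1)
    have f2 := mul_right_cancel₀ hc (show (r (k + 1) - 1 - l) * _ = 0 * _ by
      linear_combination (p (k + 1) 0 - p k 0) * c1 - (p (k + 1) 1 - p k 1) * c0)
    linarith
  have hconst : ∀ k, r k = r 0 := by
    intro k
    induction k with
    | zero => rfl
    | succ i ih => rw [hstep, ih]
    | pred i ih => rw [← ih, ← hstep, sub_add_cancel]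
  refine ⟨r 0 - 1, fun k => ?_⟩
  rw [sub_smul, ← hconst k, ← hr k]
  module

/-- A sequence satisfying the three-term recurrence satisfies one of the same form for steps of
length `m`. -/
theorem exists_add_eq_smul_of_recurrence {V : Type*} [AddCommGroup V] [Module ℝ V] {d : ℤ → V}
    {μ : ℝ} (hd : ∀ k, d (k + 1) + d (k - 1) = μ • d k) (m : ℕ) :
    ∃ ν : ℝ, ∀ k, d (k + m) + d (k - m) = ν • d k := by
  induction m using Nat.twoStepInduction with
  | zero => exact ⟨2, fun k => by simp [two_smul]⟩
  | one => exact ⟨μ, by simpa using hd⟩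
  | more m h0 h1 =>
    obtain ⟨ν₀, h0⟩ := h0
    obtain ⟨ν₁, h1⟩ := h1
    refine ⟨μ * ν₁ - ν₀, fun k => ?_⟩
    have a := hd (k + (m + 1 : ℕ))
    have b := hd (k - (m + 1 : ℕ))
    rw [sub_smul, mul_smul, ← h1 k, ← h0 k, smul_add, ← a, ← b]
    push_cast
    rw [show k + (m + 1) + 1 = k + (m + 2 : ℤ) by ring, show k + (m + 1) - 1 = k + (m : ℤ) by ring,
      show k - (m + 1) + 1 = k - (m : ℤ) by ring, show k - (m + 1) - 1 = k - (m + 2 : ℤ) by ring]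
    abel

theorem eq_apply_zero_of_apply_add_one_eq {V : Type*} {f : ℤ → V}
    (h : ∀ k, f (k + 1) = f k) (k : ℤ) : f k = f 0 := by
  induction k with
  | zero => rfl
  | succ i ih => rw [h, ih]
  | pred i ih => rw [← ih, ← h, sub_add_cancel]

/-- A closed polygon with `4 * N` vertices whose edges satisfy the recurrence is centrally
symmetric. -/
theorem add_half_period_eq {V : Type*} [AddCommGroup V] [Module ℝ V] {p : ℤ → V} {μ : ℝ}
    (hp : ∀ k, p (k + 2) - p (k + 1) + (p k - p (k - 1)) = μ • (p (k + 1) - p k)) {N : ℕ}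
    (hper : ∀ k, p (k + 4 * N) = p k) (hne : p (2 * N) ≠ p 0) (k : ℤ) :
    p (k + 2 * N) + p k = p (2 * N) + p 0 := by
  obtain ⟨ν, hν⟩ := exists_add_eq_smul_of_recurrence (d := fun k => p (k + 1) - p k) (μ := μ)
    (fun k => by simpa [add_assoc] using hp k) N
  have hν0 : ν = 0 := by
    by_contra h0
    -- Otherwise the edges would have period `2 * N`, and translation by half a period would move
    -- each vertex by the same vector, twice which vanishes.
    have hd : ∀ k, p (k + 2 * N + 1) - p (k + 2 * N) = p (k + 1) - p k := by
      intro k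
      have a := hν (k + 2 * N)
      have b := hν k
      rw [← sub_eq_zero]
      refine (smul_eq_zero.1 ?_).resolve_left h0
      rw [smul_sub, ← a, ← b]
      have e1 := hper (k - N)
      have e2 := hper (k - N + 1)
      rw [show k - N + 4 * N = k + 2 * N + (N : ℤ) by ring] at e1
      rw [show k - N + 1 + 4 * N = k + 2 * N + (N : ℤ) + 1 by ring] at e2
      rw [e1, e2, show k + 2 * N - N = k + (N : ℤ) by ring]
      abel
    have hw := eq_apply_zero_of_apply_add_one_eq (f := fun k => p (k + 2 * N) - p k) fun k => by
      have := hd k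
      rw [show k + 1 + 2 * (N : ℤ) = k + 2 * N + 1 by ring, ← sub_eq_zero] at *
      rw [← this]
      abel
    have w2 := hw (2 * N)
    have e := hper 0
    simp only [zero_add] at w2 e
    rw [show 2 * (N : ℤ) + 2 * N = 4 * N by ring, e] at w2
    have : (2 : ℝ) • (p (2 * N) - p 0) = 0 := by
      rw [two_smul]
      nth_rewrite 1 [← w2]
      abel
    exact hne (sub_eq_zero.1 ((smul_eq_zero.1 this).resolve_left two_ne_zero))
  have hw := eq_apply_zero_of_apply_add_one_eq (f := fun k => p (k + 2 * N) + p k) fun k => by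
    have := hν (k + N)
    rw [hν0, zero_smul, show k + N + N = k + 2 * (N : ℤ) by ring, add_sub_cancel_right] at this
    rw [show k + 1 + 2 * (N : ℤ) = k + 2 * N + 1 by ring, ← sub_eq_zero, ← this]
    abel
  simpa using hw k

/-- The area form of two terms depends only on their relative position: the shift operator of the
recurrence has determinant `1`. -/
theorem cross_shift {q : ℤ → Plane} {μ : ℝ} (hq : ∀ k, q (k + 1) + q (k - 1) = μ • q k)
    (j k : ℤ) : cross (q (j + 1)) (q (k + 1)) = cross (q j) (q k) := by
  have hc : ∀ i k, q (k + 1) i + q (k - 1) i = μ * q k i := fun i k =>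
    congrArg (fun x : Plane => x i) (hq k)
  have aux : ∀ (m : ℕ) (j : ℤ), cross (q (j + 1)) (q (j + 1 + m)) = cross (q j) (q (j + m)) := by
    intro m
    induction m using Nat.twoStepInduction with
    | zero => intro j; simp [cross, mul_comm]
    | one =>
      intro j
      have a0 := hc 0 (j + 1)
      have a1 := hc 1 (j + 1)
      rw [add_sub_cancel_right] at a0 a1
      simp only [cross, Nat.cast_one]
      linear_combination q (j + 1) 0 * a1 - q (j + 1) 1 * a0
    | more m h0 h1 =>
      intro j
      have h0 := h0 j
      have h1 := h1 j
      have a0 := hc 0 (j + (m + 1))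
      have a1 := hc 1 (j + (m + 1))
      have b0 := hc 0 (j + 1 + (m + 1))
      have b1 := hc 1 (j + 1 + (m + 1))
      push_cast at *
      rw [show j + (m + 1) + 1 = j + (m + 2 : ℤ) by ring,
        show j + (m + 1) - 1 = j + (m : ℤ) by ring] at a0 a1
      rw [show j + 1 + (m + 1) + 1 = j + 1 + (m + 2 : ℤ) by ring,
        show j + 1 + (m + 1) - 1 = j + 1 + (m : ℤ) by ring] at b0 b1
      simp only [cross] at *
      linear_combination μ * h1 - h0 + q (j + 1) 0 * b1 - q (j + 1) 1 * b0 - q j 0 * a1 + q j 1 * a0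
  rcases le_total j k with h | h
  · obtain ⟨m, rfl⟩ := Int.le.dest h
    have := aux m j
    rwa [show j + 1 + (m : ℤ) = j + m + 1 by ring] at this
  · obtain ⟨m, rfl⟩ := Int.le.dest h
    have := aux m k
    rw [show k + 1 + (m : ℤ) = k + m + 1 by ring] at this
    simp only [cross] at *
    linarith

/-- The vertices of a centrally symmetric polygon satisfying the recurrence lie on the ellipse with
conjugate semidiameters `q 0` and `q N`, provided these are independent. -/
theorem cross_sq_add_cross_sq {q : ℤ → Plane} {μ : ℝ}
    (hq : ∀ k, q (k + 1) + q (k - 1) = μ • q k) {N : ℕ} (hN : q (2 * N) = -q 0) (k : ℤ) :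
    cross (q k) (q N) ^ 2 + cross (q 0) (q k) ^ 2 = cross (q 0) (q N) ^ 2 := by
  have shift : ∀ (n : ℕ) (j k : ℤ), cross (q (j + n)) (q (k + n)) = cross (q j) (q k) := by
    intro n
    induction n with
    | zero => simp
    | succ n ih =>
      intro j k
      push_cast
      rw [← add_assoc, ← add_assoc, cross_shift hq, ih]
  obtain ⟨n, hn⟩ : ∃ n : ℕ, k = n ∨ k = -n := ⟨k.natAbs, Int.natAbs_eq k⟩
  have h1 := shift N 0 k
  have h2 := shift N N k
  have h3 : cross (q k) (q (k + N)) = cross (q 0) (q N) := by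
    rcases hn with rfl | rfl
    · simpa [add_comm] using shift n 0 N
    · simpa [add_comm] using (shift n (-n) (-n + N)).symm
  rw [zero_add] at h1
  rw [show (N : ℤ) + N = 2 * N by ring, hN] at h2
  simp only [cross, PiLp.neg_apply] at *
  -- The Plücker relation for `q 0`, `q N`, `q k` and `q (k + N)`.
  linear_combination (q 0 0 * q N 1 - q 0 1 * q N 0) * h3
    - (q 0 0 * q k 1 - q 0 1 * q k 0) * h1 - (q N 0 * q k 1 - q N 1 * q k 0) * h2

/-! ### The curve lies on an ellipse -/

/-- The points of the curve at rational multiples of the period satisfy the equation of one fixed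
ellipse, centred at `c`, with conjugate semidiameters `γ 0 - c` and `γ (L / 4) - c`. For a multiple
with denominator `N` this is a statement about the inscribed polygon with `4 * N` vertices. -/
theorem cross_sq_add_cross_sq_of_rat {Γ : Set Plane} (hΓ : IsOval Γ) {γ : ℝ → Plane} {L : ℝ}
    (hγ : IsClosedParametrization γ L Γ)
    (hT : ∀ u v : Plane, u ≠ 0 → v ≠ 0 →
      ∃ c : ℝ, ∀ t : ℝ, chordMap Γ u v (γ t) = γ (t + c))
    {c : Plane} (hc : c = (2⁻¹ : ℝ) • (γ 0 + γ (L / 2))) (x : ℚ) :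
    cross (γ (x * L) - c) (γ (L / 4) - c) ^ 2 + cross (γ 0 - c) (γ (x * L) - c) ^ 2
      = cross (γ 0 - c) (γ (L / 4) - c) ^ 2 := by
  set N := x.den with hNdef
  have hN : (0 : ℝ) < N := by exact_mod_cast x.den_pos
  have hL := hγ.pos
  set p : ℤ → Plane := fun k => γ (k * (L / (4 * N))) with hpdef
  have hinj : ∀ i j : ℤ, p i = p j → (4 * N : ℤ) ∣ i - j := by
    intro i j h
    obtain ⟨n, hn⟩ := hγ.exists_eq_add_int_mul h
    refine ⟨n, ?_⟩
    have : (i : ℝ) - j = 4 * N * n := by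
      field_simp at hn
      linarith
    exact_mod_cast this
  have hN1 : (1 : ℤ) ≤ N := by exact_mod_cast x.den_pos
  have hne' : ∀ i j : ℤ, j < i → i < j + 4 * N → p i ≠ p j := by
    intro i j h1 h2 h
    have := Int.le_of_dvd (by linarith) (hinj i j h)
    linarith
  have hmem : ∀ k, p k ∈ Γ := fun k => hγ.mem _
  have hper : ∀ k, p (k + 4 * N) = p k := by
    intro k
    simp only [hpdef]
    rw [← hγ.periodic (k * _)]
    congr 1
    push_cast
    field_simp
  obtain ⟨μ, hμ⟩ := exists_edge_recurrence (p := p)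
    (fun i j k l h hij => exists_sub_eq_smul_sub hΓ hγ hT
      (by rw [← add_mul, ← add_mul]; exact_mod_cast congrArg (fun z : ℤ => (z : ℝ) * _) h) hij)
    (fun k => cross_ne_zero_of_mem hΓ (hmem _) (hmem _) (hmem _)
      (hne' _ _ (by linarith) (by linarith)).symm (hne' _ _ (by linarith) (by linarith)).symm
      (hne' _ _ (by linarith) (by linarith)).symm)
    (fun k => hne' _ _ (by linarith) (by linarith))
    (fun k => hne' _ _ (by linarith) (by linarith))
  have hsym := add_half_period_eq hμ hper (hne' _ _ (by linarith) (by linarith))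
  have p0 : p 0 = γ 0 := by simp [hpdef]
  have p2 : p (2 * N) = γ (L / 2) := by
    simp only [hpdef]
    congr 1
    push_cast
    field_simp
    norm_num
  have p1 : p N = γ (L / 4) := by
    simp only [hpdef]
    congr 1
    push_cast
    field_simp
  have px : p (4 * x.num) = γ (x * L) := by
    simp only [hpdef]
    congr 1
    push_cast
    have : (x : ℝ) = x.num / N := by exact_mod_cast (Rat.num_div_den x).symm
    rw [this]
    field_simp
  have hc2 : p (2 * N) + p 0 = (2 : ℝ) • c := by
    rw [hc, p0, p2, smul_smul]
    norm_num
    abel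
  rw [hc2] at hsym
  -- The recurrence for the vertices has a constant term, which central symmetry identifies.
  have hrec : ∀ k, p (k + 1) + p (k - 1) - μ • p k = (2 - μ) • c := by
    have hstep := eq_apply_zero_of_apply_add_one_eq (f := fun k => p (k + 1) + p (k - 1) - μ • p k) fun k => by
      have := hμ k
      rw [show k + 1 + 1 = k + 2 by ring, add_sub_cancel_right, ← sub_eq_zero]
      rw [← sub_eq_zero] at this
      rw [← this]
      module
    intro k
    have a := hstep k
    have b := hstep (k + 2 * N)
    have s1 := hsym (k + 1)
    have s2 := hsym (k - 1)
    have s3 := hsym k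
    rw [show k + 1 + 2 * (N : ℤ) = k + 2 * N + 1 by ring] at s1
    rw [show k - 1 + 2 * (N : ℤ) = k + 2 * N - 1 by ring] at s2
    rw [← a] at b
    rw [← eq_sub_iff_add_eq] at s1 s2 s3
    rw [s1, s2, s3] at b
    have h2 : (2 : ℝ) • (p (k + 1) + p (k - 1) - μ • p k) = (2 : ℝ) • ((2 - μ) • c) := by
      rw [two_smul]
      nth_rewrite 1 [← b]
      module
    exact smul_right_injective _ two_ne_zero h2
  have key := cross_sq_add_cross_sq (q := fun k => p k - c) (μ := μ) (N := N)
    (fun k => by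
      have := hrec k
      rw [sub_eq_iff_eq_add] at this
      calc p (k + 1) - c + (p (k - 1) - c) = p (k + 1) + p (k - 1) - (2 : ℝ) • c := by module
        _ = μ • (p k - c) := by rw [this]; module)
    (by
      rw [eq_sub_of_add_eq hc2]
      module) (4 * x.num)
  simp only [p0, p1, px] at key
  exact key

theorem continuous_cross {X : Type*} [TopologicalSpace X] {f g : X → Plane} (hf : Continuous f)
    (hg : Continuous g) : Continuous fun x => cross (f x) (g x) := by
  unfold cross
  fun_prop

theorem cross_sq_add_cross_sq_of_real {Γ : Set Plane} (hΓ : IsOval Γ) {γ : ℝ → Plane} {L : ℝ}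
    (hγ : IsClosedParametrization γ L Γ)
    (hT : ∀ u v : Plane, u ≠ 0 → v ≠ 0 →
      ∃ c : ℝ, ∀ t : ℝ, chordMap Γ u v (γ t) = γ (t + c))
    {c : Plane} (hc : c = (2⁻¹ : ℝ) • (γ 0 + γ (L / 2))) (t : ℝ) :
    cross (γ t - c) (γ (L / 4) - c) ^ 2 + cross (γ 0 - c) (γ t - c) ^ 2
      = cross (γ 0 - c) (γ (L / 4) - c) ^ 2 := by
  have hγc := hγ.continuous
  have hcont : Continuous fun x : ℝ =>
      cross (γ (x * L) - c) (γ (L / 4) - c) ^ 2 + cross (γ 0 - c) (γ (x * L) - c) ^ 2 :=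
    ((continuous_cross (by fun_prop) (by fun_prop)).pow 2).add
      ((continuous_cross (by fun_prop) (by fun_prop)).pow 2)
  have := congrFun (Rat.denseRange_cast.equalizer hcont continuous_const
    (funext fun x => cross_sq_add_cross_sq_of_rat hΓ hγ hT hc x)) (t / L)
  simpa only [div_mul_cancel₀ t hγ.pos.ne'] using this

/-! ### Compact sets bounded by a subset of the circle -/

theorem exists_pos_add_smul_mem_frontier {E : Type*} [NormedAddCommGroup E] [NormedSpace ℝ E]
    {K : Set E} (hK : Bornology.IsBounded K) {o w : E} (ho : o ∈ interior K) (hw : w ≠ 0) :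
    ∃ s : ℝ, 0 < s ∧ o + s • w ∈ frontier K := by
  have hpre : IsPreconnected ((fun r : ℝ => o + r • w) '' Set.Ici 0) :=
    isPreconnected_Ici.image _ (by fun_prop)
  have hout : ∃ x ∈ (fun r : ℝ => o + r • w) '' Set.Ici 0, x ∉ K := by
    obtain ⟨C, hC⟩ := hK.exists_norm_le
    have hw' := norm_pos_iff.2 hw
    have hC0 : 0 ≤ C := (norm_nonneg o).trans (hC o (interior_subset ho))
    refine ⟨_, ⟨(C + 1 + ‖o‖) / ‖w‖, Set.mem_Ici.2 (by positivity), rfl⟩, fun hmem => ?_⟩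
    have h1 := hC _ hmem
    have h2 : ‖((C + 1 + ‖o‖) / ‖w‖) • w‖ = C + 1 + ‖o‖ := by
      rw [norm_smul, Real.norm_of_nonneg (by positivity), div_mul_cancel₀ _ hw'.ne']
    have h3 := norm_sub_le (o + ((C + 1 + ‖o‖) / ‖w‖) • w) o
    rw [add_sub_cancel_left, h2] at h3
    linarith
  have hmeet : ∃ x ∈ (fun r : ℝ => o + r • w) '' Set.Ici 0, x ∈ frontier K := by
    by_contra! hno
    obtain ⟨x, hx, hxK⟩ := hout
    obtain ⟨y, -, hy, hy'⟩ := hpre (interior K) (closure K)ᶜ isOpen_interior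
      isClosed_closure.isOpen_compl
      (fun z hz => or_iff_not_imp_left.2 fun h1 h2 => hno z hz ⟨h2, h1⟩)
      ⟨o, ⟨0, Set.self_mem_Ici, by simp⟩, ho⟩
      ⟨x, hx, fun h => hno x hx ⟨h, fun h => hxK (interior_subset h)⟩⟩
    exact hy' (interior_subset_closure hy)
  obtain ⟨_, ⟨s, hs, rfl⟩, hf⟩ := hmeet
  rcases (Set.mem_Ici.1 hs).eq_or_lt with rfl | h
  · simp only [zero_smul, add_zero] at hf
    exact absurd ho hf.2
  · exact ⟨s, h, hf⟩

/-- A bounded set with interior points whose frontier lies on the unit sphere is bounded by the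
whole sphere: every ray from an interior point meets the frontier, and meets the sphere only once. -/
theorem frontier_eq_sphere_of_subset {E : Type*} [NormedAddCommGroup E] [InnerProductSpace ℝ E]
    [Nontrivial E] {K : Set E} (hK : Bornology.IsBounded K) (hint : (interior K).Nonempty)
    (hsub : frontier K ⊆ Metric.sphere 0 1) : frontier K = Metric.sphere 0 1 := by
  obtain ⟨o, ho⟩ := hint
  have hsq : ∀ (w : E) (s : ℝ), o + s • w ∈ frontier K →
      ‖o‖ ^ 2 + 2 * s * inner ℝ o w + s ^ 2 * ‖w‖ ^ 2 = 1 := by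
    intro w s h
    have h1 := mem_sphere_zero_iff_norm.1 (hsub h)
    have h2 := norm_add_sq_real o (s • w)
    rw [h1, inner_smul_right, norm_smul, mul_pow, Real.norm_eq_abs, sq_abs] at h2
    linarith
  have hlt : ‖o‖ ^ 2 < 1 := by
    obtain ⟨w, hw⟩ := exists_ne (0 : E)
    obtain ⟨s, hs, hs'⟩ := exists_pos_add_smul_mem_frontier hK ho hw
    obtain ⟨r, hr, hr'⟩ := exists_pos_add_smul_mem_frontier hK ho (neg_ne_zero.2 hw)
    have e1 := hsq _ _ hs'
    have e2 := hsq _ _ hr'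
    rw [inner_neg_right, norm_neg] at e2
    have hw' := norm_pos_iff.2 hw
    -- Eliminate the inner product from the two equations.
    have e3 : (s + r) * (1 - ‖o‖ ^ 2) = (s + r) * (s * r * ‖w‖ ^ 2) := by
      linear_combination -r * e1 - s * e2
    have e4 := mul_left_cancel₀ (by positivity) e3
    have : 0 < s * r * ‖w‖ ^ 2 := by positivity
    linarith
  refine hsub.antisymm fun x hx => ?_
  have hx1 := mem_sphere_zero_iff_norm.1 hx
  have hxo : x - o ≠ 0 := by
    intro h
    rw [← sub_eq_zero.1 h, hx1] at hlt
    norm_num at hlt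
  obtain ⟨s, hs, hs'⟩ := exists_pos_add_smul_mem_frontier hK ho hxo
  have e1 := hsq _ _ hs'
  have e2 : ‖o‖ ^ 2 + 2 * inner ℝ o (x - o) + ‖x - o‖ ^ 2 = 1 := by
    rw [← norm_add_sq_real, add_sub_cancel, hx1, one_pow]
  have e3 : (1 - s) * (1 - ‖o‖ ^ 2 + s * ‖x - o‖ ^ 2) = 0 := by
    linear_combination s * e2 - e1
  have hpos : 0 < 1 - ‖o‖ ^ 2 + s * ‖x - o‖ ^ 2 := by
    have : 0 ≤ s * ‖x - o‖ ^ 2 := by positivity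
    linarith
  have hs1 : s = 1 := by
    have := (mul_eq_zero.1 e3).resolve_right hpos.ne'
    linarith
  rwa [hs1, one_smul, add_sub_cancel] at hs'

/-! ### Affine frames -/

theorem exists_affineEquiv_of_cross_ne_zero (c : Plane) {A B : Plane} (h : cross A B ≠ 0) :
    ∃ f : Plane ≃ᵃ[ℝ] Plane, ∀ x : Plane, f x = c + (x 0 • A + x 1 • B) := by
  let g : Plane →ₗ[ℝ] Plane :=
    { toFun := fun x => x 0 • A + x 1 • B
      map_add' := fun x y => by simp only [PiLp.add_apply]; module
      map_smul' := fun r x => by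
        simp only [PiLp.smul_apply, smul_eq_mul, RingHom.id_apply]; module }
  have hg : Function.Injective g := by
    rw [← LinearMap.ker_eq_bot, LinearMap.ker_eq_bot']
    intro x hx
    have c0 : x 0 * A 0 + x 1 * B 0 = 0 := congrArg (fun y : Plane => y 0) hx
    have c1 : x 0 * A 1 + x 1 * B 1 = 0 := congrArg (fun y : Plane => y 1) hx
    unfold cross at h
    have f0 := mul_right_cancel₀ h (show x 0 * _ = 0 * _ by
      linear_combination B 1 * c0 - B 0 * c1)
    have f1 := mul_right_cancel₀ h (show x 1 * _ = 0 * _ by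
      linear_combination A 0 * c1 - A 1 * c0)
    ext i
    fin_cases i
    · exact f0
    · exact f1
  refine ⟨(LinearEquiv.ofInjectiveEndo g hg).toAffineEquiv.trans (AffineEquiv.constVAdd ℝ _ c),
    fun x => ?_⟩
  simp [g]

theorem theorem2 (Γ : Set Plane) (hΓ : IsOval Γ)
    (γ : ℝ → Plane) (L : ℝ) (hγ : IsClosedParametrization γ L Γ)
    (hT : ∀ u v : Plane, u ≠ 0 → v ≠ 0 →
      ∃ c : ℝ, ∀ t : ℝ, chordMap Γ u v (γ t) = γ (t + c)) :
    IsEllipse Γ := by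
  obtain ⟨c, hc⟩ : ∃ c, c = (2⁻¹ : ℝ) • (γ 0 + γ (L / 2)) := ⟨_, rfl⟩
  have hL := hγ.pos
  have hconic := cross_sq_add_cross_sq_of_real hΓ hγ hT hc
  have hne : ∀ a b : ℝ, a ∈ Set.Ico 0 L → b ∈ Set.Ico 0 L → a ≠ b → γ a ≠ γ b :=
    fun a b ha hb hab h => hab (hγ.injOn ha hb h)
  have hD : cross (γ 0 - c) (γ (L / 4) - c) ≠ 0 := by
    have h := cross_ne_zero_of_mem hΓ (hγ.mem 0) (hγ.mem (L / 4)) (hγ.mem (L / 2))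
      (hne _ _ (by constructor <;> linarith) (by constructor <;> linarith) (by linarith))
      (hne _ _ (by constructor <;> linarith) (by constructor <;> linarith) (by linarith))
      (hne _ _ (by constructor <;> linarith) (by constructor <;> linarith) (by linarith))
    contrapose! h
    simp only [hc, cross, PiLp.sub_apply, PiLp.smul_apply, PiLp.add_apply, smul_eq_mul] at h ⊢
    linear_combination 2 * h
  obtain ⟨f, hf⟩ := exists_affineEquiv_of_cross_ne_zero c hD
  obtain ⟨K, hK, -, hint, hfr⟩ := hΓ.strictlyConvex
  let e : Plane ≃ₜ Plane := f.toContinuousAffineEquiv.toHomeomorph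
  have he : ∀ x, e x = f x := fun x => rfl
  have hsphere : ∀ x : Plane, x ∈ Metric.sphere (0 : Plane) 1 ↔ x 0 ^ 2 + x 1 ^ 2 = 1 := by
    intro x
    rw [mem_sphere_zero_iff_norm, EuclideanSpace.norm_eq, Real.sqrt_eq_one, Fin.sum_univ_two]
    simp
  have hfrontier : frontier (e ⁻¹' K) = Metric.sphere (0 : Plane) 1 := by
    refine frontier_eq_sphere_of_subset (e.isCompact_preimage.2 hK).isBounded ?_ ?_
    · rw [← e.preimage_interior]
      exact hint.preimage e.surjective
    · rw [← e.preimage_frontier, hfr, ← hγ.range_eq]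
      rintro x ⟨t, ht⟩
      rw [hsphere]
      have h := hconic t
      rw [ht, he, hf, add_sub_cancel_left] at h
      refine mul_right_cancel₀ (pow_ne_zero 2 hD) ?_
      rw [one_mul]
      refine Eq.trans ?_ h
      simp only [cross, PiLp.smul_apply, PiLp.add_apply, smul_eq_mul]
      ring
  refine ⟨f, ?_⟩
  rw [← hfrontier, ← e.preimage_frontier, hfr]
  exact (Set.image_preimage_eq Γ e.surjective).symm
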